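/- Let $\mathcal C=\{0,1\}^{\mathbb N}$ be the Cantor set. There exist a group $\Gamma$ with a finite symmetric generating set $\Sigma$ and a continuous action $\Gamma\curvearrowright\mathcal C$ that is proper, minimal and almost finite, but not topologically amenable, neither as an action of $\Gamma$ nor in the sense of its étale orbit groupoid. Here: - The action is *proper* if, whenever $\gamma x=x$ for some $\gamma\in\Gamma$, $x\in\mathcal C$, there is an open set $U\ni x$ with $\gamma y=y$ for all $y\in U$. It is *minimal* if all its orbits are dense. - Let $E$ be the graph on $\mathcal C$ in which $x\ne y$ are adjacent if $y=\sigma x$ for some $\sigma\in\Sigma$. For a finite $H\subset\mathcal C$ let $\partial H$ be the set of points of $H$ that have an $E$-neighbour outside $H$. The action is *almost finite* if for every $\varepsilon>0$ there are finitely many pairs $(S_j,F_j)$ with $S_j\subset\mathcal C$ clopen and $F_j\subset\Gamma$ finite such that the tiles $F_js=\{\gamma s:\gamma\in F_j\}$ ($s\in S_j$, all $j$) are pairwise disjoint, cover $\mathcal C$, and satisfy $|\partial(F_js)|\le\varepsilon|F_js|$. - The action is *topologically amenable* if for every finite $K\subset\Gamma$ and $\varepsilon>0$ there is a continuous map $x\mapsto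 m_x$ from $\mathcal C$ to the space of probability measures on $\Gamma$ (with the topology of pointwise convergence) such that $\|\gamma m_x-m_{\gamma x}\|_1\le\varepsilon$ for all $\gamma\in K$ and $x\in\mathcal C$. - The *orbit groupoid* of a proper action is its groupoid of germs, that is, the orbit equivalence relation with the étale topology whose basic open sets are $\{(x,\gamma x):x\in U\}$, $\gamma\in\Gamma$, $U$ open. It is *topologically amenable* if for every finite $K\subset\Gamma$ and $\varepsilon>0$ there are probability measures $p_x$ on the orbits $\Gamma x$, $x\in\mathcal C$, such that $x\mapsto p_x(\{\gamma x\})$ is continuous for every $\gamma\in\Gamma$, and $\|p_x-p_{\gamma x}\|_1\le\varepsilon$ for all $\gamma\in K$ and $x\in\mathcal C$. -/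

import Mathlib

open Topology

/-- The Cantor set `{0,1}^ℕ` with the product topology. -/
abbrev CantorSpace : Type := ℕ → Bool

namespace CantorAction

section Defs

variable {Γ X : Type*} [Group Γ] [MulAction Γ X]

/-- The graph of the action with respect to a set `Sig` of generators: distinct points `x, y` are
adjacent if one of them is mapped to the other by an element of `Sig`. -/
def orbitGraph (Sig : Finset Γ) : SimpleGraph X :=
  SimpleGraph.fromRel fun x y => ∃ σ ∈ Sig, σ • x = y

/-- The (inner vertex) boundary of a set `H` of vertices: the points of `H` that have a neighbour
outside `H`. (A neighbour of a vertex lies in the connected component of this vertex, so for a set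
inside one component it does not matter whether the boundary is taken in the component or in the
whole graph.) -/
def innerBoundary (G : SimpleGraph X) (H : Set X) : Set X :=
  {x | x ∈ H ∧ ∃ y, y ∉ H ∧ G.Adj x y}

/-- The isoperimetric constant `|∂H| / |H|` of a finite set `H` of vertices. -/
noncomputable def isoperimetricConstant (G : SimpleGraph X) (H : Set X) : ℝ :=
  ((innerBoundary G H).ncard : ℝ) / (H.ncard : ℝ)

/-- The tile `F s = {γ s : γ ∈ F}`. -/
def tile (F : Finset Γ) (s : X) : Set X :=
  (fun γ : Γ => γ • s) '' (F : Set Γ)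

variable [TopologicalSpace X]

/-- `(S, F)` is a clopen tower: `S` is clopen and the tiles `F s`, `s ∈ S`, are pairwise
disjoint. -/
def IsClopenTower (S : Set X) (F : Finset Γ) : Prop :=
  IsClopen S ∧ ∀ s ∈ S, ∀ t ∈ S, s ≠ t → Disjoint (tile F s) (tile F t)

/-- The towers `(S j, F j)` form a full clopen `ε`-castle: the tiles of all the towers partition
the space, and every tile has isoperimetric constant at most `ε`. -/
def IsFullClopenCastle (Sig : Finset Γ) (ε : ℝ) {m : ℕ} (S : Fin m → Set X)
    (F : Fin m → Finset Γ) : Prop :=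
  (∀ j, IsClopenTower (S j) (F j)) ∧
  (∀ i j, i ≠ j → ∀ s ∈ S i, ∀ t ∈ S j, Disjoint (tile (F i) s) (tile (F j) t)) ∧
  (∀ x : X, ∃ j, ∃ s ∈ S j, x ∈ tile (F j) s) ∧
  (∀ j, ∀ s ∈ S j, isoperimetricConstant (orbitGraph Sig) (tile (F j) s) ≤ ε)

variable (X) in
/-- The action is almost finite: it has a full clopen `ε`-castle for every `ε > 0`. -/
def IsAlmostFinite (Sig : Finset Γ) : Prop :=
  ∀ ε : ℝ, 0 < ε → ∃ (m : ℕ) (S : Fin m → Set X) (F : Fin m → Finset Γ),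
    IsFullClopenCastle Sig ε S F

variable (Γ X)

/-- The action is proper: all stabilizers are stable, i.e. a group element that fixes a point
fixes a neighbourhood of this point pointwise. -/
def IsProperAction : Prop :=
  ∀ (γ : Γ) (x : X), γ • x = x → ∃ U : Set X, IsOpen U ∧ x ∈ U ∧ ∀ y ∈ U, γ • y = y

/-- The action is topologically amenable: there are continuous maps `x ↦ m x` from `X` to the
probability measures on the discrete group `Γ` (with pointwise convergence) that are uniformly
almost equivariant, `‖γ (m x) - m (γ x)‖₁ ≤ ε` for all `x` and all `γ` in a prescribed finite set. -/
def IsTopologicallyAmenable : Prop :=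
  ∀ (E : Finset Γ) (ε : ℝ), 0 < ε → ∃ m : X → Γ → ℝ,
    (∀ x h, 0 ≤ m x h) ∧ (∀ x, HasSum (m x) 1) ∧
    (∀ h, Continuous fun x => m x h) ∧
    ∀ γ ∈ E, ∀ x, ∑' h, |m x (γ⁻¹ * h) - m (γ • x) h| ≤ ε

/-- Topological amenability of the orbit equivalence relation: there are probability measures
`p x` on the orbits `Γ x` with `‖p x - p (γ x)‖₁ ≤ ε` for all `x` and all `γ` in a prescribed finite
set, where `x ↦ p x (γ x)` is continuous for every `γ`. For a proper action the groupoid of germs is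
the orbit equivalence relation, a basis of its étale topology is given by the sets
`{(x, γ x) : x ∈ U}` with `U` open, and this is topological amenability of that étale groupoid. -/
def IsOrbitGroupoidAmenable : Prop :=
  ∀ (E : Finset Γ) (ε : ℝ), 0 < ε → ∃ p : X → X → ℝ,
    (∀ x y, 0 ≤ p x y) ∧ (∀ x y, y ∉ MulAction.orbit Γ x → p x y = 0) ∧
    (∀ x, HasSum (p x) 1) ∧
    (∀ γ : Γ, Continuous fun x => p x (γ • x)) ∧
    ∀ γ ∈ E, ∀ x, ∑' y, |p x y - p (γ • x) y| ≤ ε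

end Defs

end CantorAction

/-! The group is generated by an odometer `τ` on digit sequences and a free group `F` of rank two.
`F` embeds in a compact product `K` of finite groups and acts on it freely by translations,
preserving Haar measure. Points of `K` are coded by digit sequences in which every digit determines
all earlier ones and is never 0. `F` acts on codes as on `K`; in any other sequence it changes at
most the longest initial word of a code and the digit after it.

Off the limit set, where some initial word is not that of a code, `F` therefore acts locally by
powers of `τ`. On the limit set `F` acts freely, and no `τ`-orbit meets it twice
(`eq_zero_of_zpow_mem`). So every germ has the form `τ^l g τ^j` (`germ`), whence properness.
Minimality is due to the odometer alone.

For almost finiteness, the tiles are the classes of sequences that differ only in the first `m`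
digits. They are segments of `τ`-orbits, and generators leave them only at the two ends or at
initial words of codes. Such words are rare: the last digit stands for a one-hot block, one of `v`
among `2^v` blocks.

Amenability fails on the sparse limit set. The orbit of a code is a copy of `F × ℤ`, so either form
of amenability, pushed to `F`, gives measurable almost equivariant probability measures on `F` over
`K`. Averaged over the invariant measure, they give an almost invariant mean on `F`, against its
paradoxical decomposition (`not_almost_equivariant`). -/

namespace Odometer

/-! ### Mixed radix odometers -/

variable {k : ℕ → ℕ}

/-- Sequences of digits in a mixed radix system with bases `k n + 1`. -/
abbrev Digits (k : ℕ → ℕ) : Type := ∀ n, Fin (k n + 1)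

theorem eventually_agree (x : Digits k) (m : ℕ) : ∀ᶠ z in 𝓝 x, ∀ i < m, z i = x i := by
  have h : ∀ i ∈ Finset.range m, ∀ᶠ z in 𝓝 x, z i = x i := fun i _ =>
    ((continuous_apply i).tendsto x).eventually
      (p := fun a => a = x i) (by rw [nhds_discrete]; exact Filter.eventually_pure.2 rfl)
  have := (Filter.eventually_all_finset _).2 h
  filter_upwards [this] with z hz i hi using hz i (Finset.mem_range.2 hi)

theorem isLocallyConstant_of_agree {B : Type*} (f : Digits k → B) (m : ℕ)
    (hf : ∀ x x' : Digits k, (∀ i < m, x i = x' i) → f x = f x') : IsLocallyConstant f :=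
  (IsLocallyConstant.iff_eventually_eq f).2 fun x => by
    filter_upwards [eventually_agree x m] with z hz using hf _ _ hz

/-- The cylinder sets form a neighbourhood basis. -/
theorem exists_agree_subset {U : Set (Digits k)} (hU : IsOpen U) {x : Digits k} (hx : x ∈ U) :
    ∃ m, ∀ z : Digits k, (∀ i < m, z i = x i) → z ∈ U := by
  obtain ⟨I, u, hu, hs⟩ := isOpen_pi_iff.1 hU x hx
  refine ⟨I.sup id + 1, fun z hz => hs fun i hi => ?_⟩
  rw [hz i (Nat.lt_succ_of_le (Finset.le_sup (f := id) hi))]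
  exact (hu i hi).2

open Classical in
/-- Adding one with carry. -/
noncomputable def succ (x : Digits k) : Digits k := fun n =>
  if ∀ i < n, x i = Fin.last _ then x n + 1 else x n

open Classical in
/-- Subtracting one with borrow. -/
noncomputable def pred (x : Digits k) : Digits k := fun n =>
  if ∀ i < n, x i = 0 then x n - 1 else x n

/-- The carry of `succ` reaches a position exactly when the borrow of `pred` in the image does, so
the two maps are inverse. -/
theorem succ_eq_zero_iff (x : Digits k) (n : ℕ) :
    (∀ i < n, succ x i = 0) ↔ ∀ i < n, x i = Fin.last _ := by
  constructor
  · intro h i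
    induction i using Nat.strong_induction_on with
    | _ i ih =>
      intro hi
      have h1 := h i hi
      rw [succ, if_pos fun j hj => ih j hj (hj.trans hi)] at h1
      have h2 : x i = 0 - 1 := by rw [← h1]; simp
      rw [h2, ← Fin.last_add_one (k i), add_sub_cancel_right]
  · intro h i hi
    rw [succ, if_pos fun j hj => h j (hj.trans hi), h i hi, Fin.last_add_one]

theorem pred_eq_last_iff (x : Digits k) (n : ℕ) :
    (∀ i < n, pred x i = Fin.last _) ↔ ∀ i < n, x i = 0 := by
  constructor
  · intro h i
    induction i using Nat.strong_induction_on with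
    | _ i ih =>
      intro hi
      have h1 := h i hi
      rw [pred, if_pos fun j hj => ih j hj (hj.trans hi)] at h1
      have h2 : x i = Fin.last _ + 1 := by rw [← h1]; simp
      rw [h2, Fin.last_add_one (k i)]
  · intro h i hi
    rw [pred, if_pos fun j hj => h j (hj.trans hi), h i hi, ← Fin.last_add_one, add_sub_cancel_right]

/-- The odometer. -/
noncomputable def odo : Equiv.Perm (Digits k) where
  toFun := succ
  invFun := pred
  left_inv x := by
    funext n
    by_cases h : ∀ i < n, x i = Fin.last _
    · rw [pred, if_pos ((succ_eq_zero_iff x n).2 h), succ, if_pos h]; simp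
    · rw [pred, if_neg (mt (succ_eq_zero_iff x n).1 h), succ, if_neg h]
  right_inv x := by
    funext n
    by_cases h : ∀ i < n, x i = 0
    · rw [succ, if_pos ((pred_eq_last_iff x n).2 h), pred, if_pos h]; simp
    · rw [succ, if_neg (mt (pred_eq_last_iff x n).1 h), pred, if_neg h]

theorem odo_apply (x : Digits k) : odo x = succ x := rfl

theorem continuous_of_agree (f : Digits k → Digits k)
    (hf : ∀ n, ∀ x x' : Digits k, (∀ i < n + 1, x i = x' i) → f x n = f x' n) : Continuous f :=
  continuous_pi fun n => (isLocallyConstant_of_agree (fun x => f x n) (n + 1) (hf n)).continuous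

theorem continuous_odo : Continuous (odo : Digits k → Digits k) := by
  refine continuous_of_agree _ fun n x x' h => ?_
  have : (∀ i < n, x i = Fin.last _) ↔ ∀ i < n, x' i = Fin.last _ :=
    forall₂_congr fun i hi => by rw [h i (hi.trans n.lt_succ_self)]
  simp only [odo_apply, succ, this, h n n.lt_succ_self]

theorem continuous_odo_zpow (j : ℤ) : Continuous (odo ^ j : Equiv.Perm (Digits k)) := by
  have hn : ∀ n : ℕ, Continuous (odo ^ n : Equiv.Perm (Digits k)) := fun n => by
    rw [Equiv.Perm.coe_pow]; exact continuous_odo.iterate n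
  obtain ⟨n, rfl | rfl⟩ := j.eq_nat_or_neg
  · rw [zpow_natCast]; exact hn n
  · rw [zpow_neg, zpow_natCast]; exact (hn n).homeoOfEquivCompactToT2.symm.continuous

/-- The number of words of length `m`. -/
def radix (k : ℕ → ℕ) (m : ℕ) : ℕ := ∏ i ∈ Finset.range m, (k i + 1)

theorem radix_succ (m : ℕ) : radix k (m + 1) = radix k m * (k m + 1) :=
  Finset.prod_range_succ _ _

theorem radix_pos (m : ℕ) : 0 < radix k m := Finset.prod_pos fun _ _ => Nat.succ_pos _

theorem two_pow_le_radix (hk : ∀ n, 1 ≤ k n) (m : ℕ) : 2 ^ m ≤ radix k m := by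
  have := Finset.prod_le_prod' (s := Finset.range m) (f := fun _ => 2) (g := fun i => k i + 1)
    fun i _ => Nat.succ_le_succ (hk i)
  simpa [radix] using this

/-- The number represented by the first `m` digits. -/
def val (x : Digits k) : ℕ → ℕ
  | 0 => 0
  | m + 1 => val x m + radix k m * (x m : ℕ)

theorem val_lt (x : Digits k) (m : ℕ) : val x m < radix k m := by
  induction m with
  | zero => simp [val, radix]
  | succ m ih =>
    rw [val, radix_succ]
    have : radix k m * (x m : ℕ) ≤ radix k m * k m :=
      Nat.mul_le_mul_left _ (Nat.lt_succ_iff.1 (x m).2)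
    rw [Nat.mul_succ]; omega

theorem agree_of_val_eq {x x' : Digits k} {m : ℕ} (h : val x m = val x' m) :
    ∀ i < m, x i = x' i := by
  induction m with
  | zero => intro i hi; omega
  | succ m ih =>
    rw [val, val] at h
    have h1 : val x m = val x' m := by
      have := congrArg (· % radix k m) h
      simpa [Nat.add_mul_mod_self_left, Nat.mod_eq_of_lt (val_lt _ m)] using this
    rw [h1] at h
    have h2 : x m = x' m := Fin.ext (Nat.eq_of_mul_eq_mul_left (radix_pos (k := k) m) (by omega))
    intro i hi
    rcases Nat.lt_succ_iff_lt_or_eq.1 hi with h | rfl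
    · exact ih h1 i h
    · exact h2

theorem val_congr {x x' : Digits k} {m : ℕ} (h : ∀ i < m, x i = x' i) : val x m = val x' m := by
  induction m with
  | zero => rfl
  | succ m ih => rw [val, val, ih fun i hi => h i (hi.trans m.lt_succ_self), h m m.lt_succ_self]

theorem val_zero {x : Digits k} {m : ℕ} (h : ∀ i < m, x i = 0) : val x m = 0 := by
  induction m with
  | zero => rfl
  | succ m ih => simp [val, ih fun i hi => h i (hi.trans m.lt_succ_self), h m m.lt_succ_self]

theorem val_last {x : Digits k} {m : ℕ} (h : ∀ i < m, x i = Fin.last _) :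
    val x m + 1 = radix k m := by
  induction m with
  | zero => rfl
  | succ m ih =>
    rw [val, radix_succ, h m m.lt_succ_self, ← ih fun i hi => h i (hi.trans m.lt_succ_self),
      Fin.val_last]
    ring

/-- A non-maximal digit below `m` stops the carry before position `m`. -/
theorem val_succ_of_not {x : Digits k} {m : ℕ} (h : ¬ ∀ i < m, x i = Fin.last _) :
    val (succ x) m = val x m + 1 ∧ ∀ i, m ≤ i → succ x i = x i := by
  induction m with
  | zero => exact absurd (fun i hi => absurd hi (Nat.not_lt_zero i)) h
  | succ m ih =>
    refine ⟨?_, fun i hi => if_neg fun h' => h fun j hj => h' j (hj.trans_le hi)⟩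
    by_cases h1 : ∀ i < m, x i = Fin.last _
    · have h2 : x m ≠ Fin.last _ := fun h2 => h fun i hi => by
        rcases Nat.lt_succ_iff_lt_or_eq.1 hi with h | rfl
        exacts [h1 i h, h2]
      have h3 : ((x m + 1 : Fin (k m + 1)) : ℕ) = x m + 1 :=
        Fin.val_add_one_of_lt (Fin.lt_last_iff_ne_last.2 h2)
      rw [val, val, val_zero ((succ_eq_zero_iff x m).2 h1), succ, if_pos h1, h3]
      have := val_last h1
      rw [← this]; ring
    · obtain ⟨h2, h3⟩ := ih h1
      rw [val, val, h2, h3 m le_rfl]; ring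

/-- Overflow is absorbed modulo `radix k m`, so the first `m` digits undergo a rotation of a finite
cyclic group. -/
theorem cast_val_odo (x : Digits k) (m : ℕ) :
    (val (odo x) m : ZMod (radix k m)) = val x m + 1 := by
  rw [odo_apply]
  by_cases h : ∀ i < m, x i = Fin.last _
  · rw [val_zero ((succ_eq_zero_iff x m).2 h)]
    have := congrArg (Nat.cast : ℕ → ZMod (radix k m)) (val_last h)
    push_cast at this
    simp [this]
  · rw [(val_succ_of_not h).1]; push_cast; rfl

theorem cast_val_zpow (j : ℤ) (x : Digits k) (m : ℕ) :
    (val ((odo ^ j) x) m : ZMod (radix k m)) = val x m + j := by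
  induction j using Int.induction_on with
  | zero => simp
  | succ i ih =>
    rw [add_comm, zpow_add, zpow_one, Equiv.Perm.mul_apply, cast_val_odo, ih]; push_cast; ring
  | pred i ih =>
    have h := cast_val_odo ((odo ^ (-(i : ℤ) - 1)) x) m
    rw [← Equiv.Perm.mul_apply, ← zpow_one_add, show 1 + (-(i : ℤ) - 1) = -i by ring, ih] at h
    rw [← sub_eq_iff_eq_add] at h
    rw [← h]; push_cast; ring

theorem eq_zero_of_zpow_apply (hk : ∀ n, 1 ≤ k n) {j : ℤ} {x : Digits k}
    (h : (odo ^ j) x = x) : j = 0 := by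
  -- A fixed point forces every `radix k m` to divide `j`; at `m = |j| + 1` the radix already
  -- exceeds `|j|`.
  have h1 := cast_val_zpow j x (j.natAbs + 1)
  rw [h, left_eq_add, ZMod.intCast_zmod_eq_zero_iff_dvd] at h1
  refine Int.eq_zero_of_abs_lt_dvd h1 ?_
  have h2 := two_pow_le_radix hk (j.natAbs + 1)
  have h3 : j.natAbs + 1 < 2 ^ (j.natAbs + 1) := Nat.lt_two_pow_self
  rw [Int.abs_eq_natAbs]
  exact_mod_cast (by omega : j.natAbs < radix k (j.natAbs + 1))

theorem val_pow {s : Digits k} {m : ℕ} (hs : ∀ i < m, s i = 0) {j : ℕ} (hj : j < radix k m) :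
    val ((odo ^ j) s) m = j ∧ ∀ i, m ≤ i → (odo ^ j) s i = s i := by
  induction j with
  | zero => exact ⟨val_zero hs, fun _ _ => rfl⟩
  | succ j ih =>
    obtain ⟨h1, h2⟩ := ih (by omega)
    have h3 : ¬ ∀ i < m, (odo ^ j) s i = Fin.last _ := fun h => by
      have := val_last h; omega
    rw [pow_succ', Equiv.Perm.mul_apply, odo_apply]
    obtain ⟨h4, h5⟩ := val_succ_of_not h3
    exact ⟨by rw [h4, h1], fun i hi => by rw [h5 i hi, h2 i hi]⟩

theorem eq_of_val_eq_of_tail {x x' : Digits k} {m : ℕ} (h : val x m = val x' m)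
    (ht : ∀ i, m ≤ i → x i = x' i) : x = x' :=
  funext fun i => (lt_or_ge i m).elim (agree_of_val_eq h i) (ht i)

theorem pow_val_of_tail {s x : Digits k} {m : ℕ} (hs : ∀ i < m, s i = 0)
    (ht : ∀ i, m ≤ i → x i = s i) : (odo ^ val x m) s = x := by
  obtain ⟨h1, h2⟩ := val_pow hs (val_lt x m)
  exact eq_of_val_eq_of_tail h1 fun i hi => by rw [h2 i hi, ht i hi]

/-- Both points are reached from the point whose first `m` digits are replaced by 0. The exponent
depends only on the first `m` digits, hence is locally constant. -/
theorem zpow_of_tail {x x' : Digits k} {m : ℕ} (ht : ∀ i, m ≤ i → x i = x' i) :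
    (odo ^ ((val x' m : ℤ) - val x m)) x = x' := by
  set s : Digits k := fun i => if i < m then 0 else x i with hsdef
  have hs : ∀ i < m, s i = 0 := fun i hi => if_pos hi
  have h1 : (odo ^ val x m) s = x := pow_val_of_tail hs fun i hi => by simp [hsdef, hi]
  have h2 : (odo ^ val x' m) s = x' :=
    pow_val_of_tail hs fun i hi => by simp [hsdef, hi, ht i hi]
  generalize val x m = a at *
  rw [← h1, ← zpow_natCast, ← Equiv.Perm.mul_apply, ← zpow_add, sub_add_cancel, zpow_natCast, h2]

/-- A step changes finitely many digits unless all are maximal, and then it produces the zero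
sequence. -/
theorem tail_or_zero (x : Digits k) (j : ℕ) :
    (∃ m, ∀ i, m ≤ i → (odo ^ j) x i = x i) ∨ ∃ m, ∀ i, m ≤ i → (odo ^ j) x i = 0 := by
  induction j with
  | zero => exact .inl ⟨0, fun _ _ => rfl⟩
  | succ j ih =>
    rw [pow_succ', Equiv.Perm.mul_apply, odo_apply]
    by_cases h : ∀ i, (odo ^ j) x i = Fin.last _
    · exact .inr ⟨0, fun i _ => (succ_eq_zero_iff _ (i + 1)).2 (fun i _ => h i) i i.lt_succ_self⟩
    · push Not at h
      obtain ⟨l, hl⟩ := h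
      have h1 := (val_succ_of_not (m := l + 1) fun h => hl (h l l.lt_succ_self)).2
      refine ih.imp ?_ ?_ <;>
      · rintro ⟨m, hm⟩
        exact ⟨max m (l + 1), fun i hi => by
          rw [h1 i (le_of_max_le_right hi), hm i (le_of_max_le_left hi)]⟩

theorem exists_zpow_agree (x y : Digits k) (m : ℕ) : ∃ j : ℤ, ∀ i < m, (odo ^ j) x i = y i := by
  obtain ⟨z, hz1, hz2⟩ : ∃ z : Digits k, (∀ i < m, z i = y i) ∧ ∀ i, m ≤ i → x i = z i :=
    ⟨fun i => if i < m then y i else x i, fun i hi => if_pos hi, fun i hi => by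
      simp [hi]⟩
  exact ⟨_, fun i hi => by rw [zpow_of_tail hz2, hz1 i hi]⟩

end Odometer

/-! ### Codings and the induced action on digit sequences -/

open Odometer CantorAction MeasureTheory
open scoped ENNReal

/-- An equivariant encoding of a space `K` with an action of a group `F` by sequences of digits:
each digit determines the preceding ones, and the digit `0` is not used. -/
structure Coding (k : ℕ → ℕ) (F K : Type*) [Group F] [MulAction F K] where
  rho : ∀ n, F →* Equiv.Perm (Fin (k n + 1))
  code : K → Digits k
  one_le : ∀ n, 1 ≤ k n
  code_smul : ∀ g y n, code (g • y) n = rho n g (code y n)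
  code_ne_zero : ∀ y n, code y n ≠ 0
  code_eq : ∀ y y' n, code y n = code y' n → ∀ i < n, code y i = code y' i
  free : ∀ g, (∀ n, ∃ y, rho n g (code y n) = code y n) → g = 1
  small : ∀ ε : ℝ, 0 < ε → ∃ m,
    ((Set.range fun (y : K) (i : Fin m) => code y i).ncard + 2 : ℝ) / radix k m ≤ ε

namespace Coding

variable {k : ℕ → ℕ} {F K : Type*} [Group F] [MulAction F K] (c : Coding k F K)

/-- The first `m` digits of `x` are those of a code. -/
def Coherent (m : ℕ) (x : Digits k) : Prop := ∃ y, ∀ i < m, x i = c.code y i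

variable {c} in
theorem Coherent.mono {m n : ℕ} (h : m ≤ n) {x : Digits k} : c.Coherent n x → c.Coherent m x :=
  fun ⟨y, hy⟩ => ⟨y, fun i hi => hy i (hi.trans_le h)⟩

theorem coherent_congr {m : ℕ} {x x' : Digits k} (h : ∀ i < m, x i = x' i) :
    c.Coherent m x ↔ c.Coherent m x' :=
  exists_congr fun _ => forall₂_congr fun i hi => by rw [h i hi]

open Classical in
/-- The group element `g` acts on the longest coherent word at the beginning of `x` and on
the next digit. -/
noncomputable def extend (g : F) (x : Digits k) : Digits k := fun n =>
  if c.Coherent n x then c.rho n g (x n) else x n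

theorem extend_of {g : F} {x : Digits k} {n : ℕ} (h : c.Coherent n x) :
    c.extend g x n = c.rho n g (x n) := if_pos h

theorem extend_of_not {g : F} {x : Digits k} {n : ℕ} (h : ¬ c.Coherent n x) :
    c.extend g x n = x n := if_neg h

theorem extend_congr (g : F) {x x' : Digits k} {n : ℕ} (h : ∀ i < n + 1, x i = x' i) :
    c.extend g x n = c.extend g x' n := by
  have h1 := c.coherent_congr fun i hi => h i (Nat.lt_succ_of_lt hi)
  by_cases h2 : c.Coherent n x
  · rw [c.extend_of h2, c.extend_of (h1.1 h2), h n n.lt_succ_self]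
  · rw [c.extend_of_not h2, c.extend_of_not (mt h1.2 h2), h n n.lt_succ_self]

/-- The image of a word coding `y` codes `g • y`. Conversely, by induction on the position, all
digits of the word have been moved by `rho`, which can be undone. This makes `extend`
multiplicative. -/
theorem coherent_extend (g : F) (x : Digits k) (n : ℕ) :
    c.Coherent n (c.extend g x) ↔ c.Coherent n x := by
  constructor
  · induction n using Nat.strong_induction_on with
    | _ n ih =>
      rintro ⟨y, hy⟩
      refine ⟨g⁻¹ • y, fun i hi => ?_⟩
      have h1 := ih i hi ⟨y, fun j hj => hy j (hj.trans hi)⟩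
      rw [c.code_smul, ← hy i hi, c.extend_of h1, ← Equiv.Perm.mul_apply, ← map_mul]
      simp
  · rintro ⟨y, hy⟩
    refine ⟨g • y, fun i hi => ?_⟩
    rw [c.extend_of ⟨y, fun j hj => hy j (hj.trans hi)⟩, hy i hi, c.code_smul]

theorem extend_one (x : Digits k) : c.extend 1 x = x := by
  funext n; simp [extend]

theorem extend_mul (g h : F) (x : Digits k) : c.extend (g * h) x = c.extend g (c.extend h x) := by
  funext n
  by_cases hn : c.Coherent n x
  · rw [c.extend_of hn, c.extend_of ((c.coherent_extend h x n).2 hn), c.extend_of hn, map_mul]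
    rfl
  · rw [c.extend_of_not hn, c.extend_of_not (mt (c.coherent_extend h x n).1 hn),
      c.extend_of_not hn]

/-- The action of `F` on sequences of digits. -/
noncomputable def ext : F →* Equiv.Perm (Digits k) where
  toFun g :=
    { toFun := c.extend g
      invFun := c.extend g⁻¹
      left_inv := fun x => by rw [← extend_mul, inv_mul_cancel, extend_one]
      right_inv := fun x => by rw [← extend_mul, mul_inv_cancel, extend_one] }
  map_one' := Equiv.ext c.extend_one
  map_mul' g h := Equiv.ext (c.extend_mul g h)

theorem ext_apply (g : F) (x : Digits k) : c.ext g x = c.extend g x := rfl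

theorem continuous_ext (g : F) : Continuous (c.ext g) :=
  continuous_of_agree _ fun _ _ _ h => c.extend_congr g h

/-- The set of sequences all of whose initial words are coherent. -/
def limitSet : Set (Digits k) := {x | ∀ n, c.Coherent n x}

theorem code_mem (y : K) : c.code y ∈ c.limitSet := fun _ => ⟨y, fun _ _ => rfl⟩

theorem ext_code (g : F) (y : K) : c.ext g (c.code y) = c.code (g • y) :=
  funext fun n => by rw [ext_apply, c.extend_of (c.code_mem y n), c.code_smul]

theorem ext_mem {x : Digits k} (hx : x ∈ c.limitSet) (g : F) : c.ext g x ∈ c.limitSet :=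
  fun n => (c.coherent_extend g x n).2 (hx n)

theorem ext_tail {g : F} {x : Digits k} {m : ℕ} (h : ¬ c.Coherent m x) {i : ℕ} (hi : m ≤ i) :
    c.ext g x i = x i :=
  c.extend_of_not fun h' => h (h'.mono hi)

/-- Once coherence fails at length `m`, digits from `m` on are kept, so the effect is that of an
odometer power fixed by the first `m` digits. -/
theorem ext_eventually_eq_zpow (g : F) {x : Digits k} (hx : x ∉ c.limitSet) :
    ∃ j : ℤ, ∀ᶠ z in 𝓝 x, c.ext g z = (odo ^ j) z := by
  obtain ⟨m, hm⟩ := not_forall.1 hx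
  refine ⟨(val (c.ext g x) m : ℤ) - val x m, ?_⟩
  filter_upwards [eventually_agree x m] with z hz
  have hz' : ¬ c.Coherent m z := mt (c.coherent_congr hz).1 hm
  have h1 : ∀ i < m, c.ext g z i = c.ext g x i := fun i hi =>
    c.extend_congr g fun j hj => hz j (by omega)
  rw [← val_congr hz, ← val_congr h1]
  exact (zpow_of_tail fun i hi => (c.ext_tail hz' hi).symm).symm

theorem ne_zero_of_mem {x : Digits k} (hx : x ∈ c.limitSet) (n : ℕ) : x n ≠ 0 := by
  obtain ⟨y, hy⟩ := hx (n + 1)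
  rw [hy n n.lt_succ_self]
  exact c.code_ne_zero y n

theorem eq_of_tail {x x' : Digits k} (hx : x ∈ c.limitSet) (hx' : x' ∈ c.limitSet) {m : ℕ}
    (h : ∀ i, m ≤ i → x i = x' i) : x = x' := by
  funext i
  -- A position past both `m` and `i`: the common digit there determines digit `i` of both points.
  have hl : i < max m (i + 1) := lt_max_of_lt_right i.lt_succ_self
  obtain ⟨y, hy⟩ := hx (max m (i + 1) + 1)
  obtain ⟨y', hy'⟩ := hx' (max m (i + 1) + 1)
  have h1 := h _ (le_max_left m (i + 1))
  rw [hy _ (Nat.lt_succ_self _), hy' _ (Nat.lt_succ_self _)] at h1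
  rw [hy i (by omega), hy' i (by omega), c.code_eq y y' _ h1 i hl]

/-- By `tail_or_zero`, either the two points have a common tail, so they coincide and freeness of
the odometer applies, or a digit 0 occurs in a code. -/
theorem eq_zero_of_zpow_mem {x : Digits k} (hx : x ∈ c.limitSet) {j : ℤ}
    (h : (odo ^ j) x ∈ c.limitSet) : j = 0 := by
  have key : ∀ (x : Digits k) (n : ℕ), x ∈ c.limitSet → (odo ^ n) x ∈ c.limitSet →
      (n : ℤ) = 0 := by
    intro x n hx h
    rcases tail_or_zero x n with ⟨m, hm⟩ | ⟨m, hm⟩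
    · refine eq_zero_of_zpow_apply c.one_le (x := x) ?_
      rw [zpow_natCast]
      exact c.eq_of_tail h hx hm
    · exact absurd (hm m le_rfl) (c.ne_zero_of_mem h m)
  obtain ⟨n, rfl | rfl⟩ := j.eq_nat_or_neg
  · exact key x n hx (by rwa [zpow_natCast] at h)
  · rw [key _ n h ?_, neg_zero]
    rw [← zpow_natCast, ← Equiv.Perm.mul_apply, ← zpow_add, add_neg_cancel, zpow_zero]
    exact hx

theorem eq_one_of_ext {x : Digits k} (hx : x ∈ c.limitSet) {g : F} (h : c.ext g x = x) :
    g = 1 := by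
  refine c.free g fun n => ?_
  obtain ⟨y, hy⟩ := hx (n + 1)
  refine ⟨y, ?_⟩
  rw [← hy n n.lt_succ_self, ← c.extend_of (hx n), ← ext_apply, h]

end Coding

/-! ### Germs, properness and minimality -/

namespace Coding

variable {k : ℕ → ℕ} {F K : Type*} [Group F] [MulAction F K] (c : Coding k F K)

/-- The group `Γ` is generated by an element `τ` acting as the odometer and by the image of a
homomorphism from `F` that induces the action of `F` on sequences of digits. -/
structure IsRealization {Γ : Type*} [Group Γ] [MulAction Γ (Digits k)] (τ : Γ) (ι : F →* Γ) :
    Prop where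
  odo_smul : ∀ x : Digits k, τ • x = odo x
  ext_smul : ∀ g (x : Digits k), ι g • x = c.ext g x
  closure_eq : Subgroup.closure (insert τ (Set.range ι)) = ⊤

namespace IsRealization

variable {c} {Γ : Type*} [Group Γ] [MulAction Γ (Digits k)] {τ : Γ} {ι : F →* Γ}
  (h : c.IsRealization τ ι)
include h

theorem zpow_smul (j : ℤ) (x : Digits k) : τ ^ j • x = (odo ^ j) x := by
  have : MulAction.toPermHom Γ (Digits k) τ = odo := Equiv.ext h.odo_smul
  rw [← this, ← map_zpow]; rfl

theorem induction {p : Γ → Prop} (h1 : p 1) (ht : ∀ j : ℤ, p (τ ^ j)) (hg : ∀ g, p (ι g))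
    (hm : ∀ γ δ, p γ → p δ → p (γ * δ)) (γ : Γ) : p γ := by
  have hγ : γ ∈ Subgroup.closure (insert τ (Set.range ι)) := h.closure_eq ▸ Subgroup.mem_top γ
  induction hγ using Subgroup.closure_induction'' with
  | mem x hx =>
    rcases hx with rfl | ⟨g, rfl⟩
    · simpa using ht 1
    · exact hg g
  | inv_mem x hx =>
    rcases hx with rfl | ⟨g, rfl⟩
    · simpa using ht (-1)
    · simpa using hg g⁻¹
  | one => exact h1
  | mul x y _ _ hx hy => exact hm x y hx hy

theorem continuousConstSMul : ContinuousConstSMul Γ (Digits k) := by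
  refine ⟨fun γ => h.induction (p := fun γ => Continuous fun x : Digits k => γ • x) ?_ ?_ ?_ ?_ γ⟩
  · simp only [one_smul]; exact continuous_id
  · simpa only [h.zpow_smul] using continuous_odo_zpow
  · simpa only [h.ext_smul] using c.continuous_ext
  · intro γ δ hγ hδ
    simp only [mul_smul]; exact hγ.comp hδ

/-- When two such forms are multiplied, the power of `τ` between nontrivial factors from `F` joins
two points of the limit set. It is therefore trivial and the factors merge. -/
theorem germ [ContinuousConstSMul Γ (Digits k)] (γ : Γ) : ∀ x : Digits k, ∃ (l j : ℤ) (g : F),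
    (g = 1 ∨ τ ^ j • x ∈ c.limitSet) ∧ ∀ᶠ z in 𝓝 x, γ • z = (τ ^ l * ι g * τ ^ j) • z := by
  refine h.induction (p := fun γ => ∀ x : Digits k, ∃ (l j : ℤ) (g : F),
    (g = 1 ∨ τ ^ j • x ∈ c.limitSet) ∧ ∀ᶠ z in 𝓝 x, γ • z = (τ ^ l * ι g * τ ^ j) • z)
    ?_ ?_ ?_ ?_ γ
  · exact fun x => ⟨0, 0, 1, .inl rfl, .of_forall fun z => by simp⟩
  · exact fun j x => ⟨j, 0, 1, .inl rfl, .of_forall fun z => by simp⟩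
  · intro g x
    by_cases hx : x ∈ c.limitSet
    · exact ⟨0, 0, g, .inr (by simpa using hx), .of_forall fun z => by simp⟩
    · obtain ⟨j, hj⟩ := c.ext_eventually_eq_zpow g hx
      refine ⟨j, 0, 1, .inl rfl, hj.mono fun z hz => ?_⟩
      rw [h.ext_smul, hz, ← h.zpow_smul]; simp
  · intro γ δ hγ hδ x
    obtain ⟨l, j, g, hg, he⟩ := hδ x
    obtain ⟨l', j', g', hg', he'⟩ := hγ (δ • x)
    have he2 : ∀ᶠ z in 𝓝 x, (γ * δ) • z =
        (τ ^ l' * ι g' * τ ^ j' * (τ ^ l * ι g * τ ^ j)) • z := by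
      filter_upwards [he, ((continuous_const_smul δ).tendsto x).eventually he'] with z hz hz'
      rw [mul_smul, hz', hz, ← mul_smul]
    have hx := he.self_of_nhds
    rcases eq_or_ne g' 1 with rfl | hne'
    · refine ⟨l' + j' + l, j, g, hg, he2.mono fun z hz => ?_⟩
      rw [hz]; simp [zpow_add, mul_assoc]
    rcases eq_or_ne g 1 with rfl | hne
    · refine ⟨l', j' + l + j, g', .inr ?_, he2.mono fun z hz => ?_⟩
      · have := hg'.resolve_left hne'
        rw [hx] at this
        simpa [zpow_add, mul_smul] using this
      · rw [hz]; simp [zpow_add, mul_assoc]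
    · have h1 := hg.resolve_left hne
      have h2 := hg'.resolve_left hne'
      rw [hx, mul_smul, mul_smul, ← mul_smul, ← zpow_add, h.zpow_smul, h.ext_smul] at h2
      have h3 := c.eq_zero_of_zpow_mem (c.ext_mem h1 g) h2
      refine ⟨l', j, g' * g, .inr h1, he2.mono fun z hz => ?_⟩
      rw [hz, show j' = -l by omega]; simp [mul_assoc]

theorem isProperAction [ContinuousConstSMul Γ (Digits k)] : IsProperAction Γ (Digits k) := by
  intro γ x hx
  obtain ⟨l, j, g, hg, he⟩ := h.germ γ x
  have h0 := he.self_of_nhds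
  rw [hx] at h0
  suffices hz : ∀ᶠ z in 𝓝 x, γ • z = z by
    obtain ⟨U, hU, hUo, hxU⟩ := eventually_nhds_iff.1 hz
    exact ⟨U, hUo, hxU, hU⟩
  rcases hg with rfl | hg
  · rw [map_one, mul_one, ← zpow_add] at h0
    have h1 := eq_zero_of_zpow_apply c.one_le ((h.zpow_smul _ x).symm.trans h0.symm)
    filter_upwards [he] with z hz
    rw [hz, map_one, mul_one, ← zpow_add, h1]; simp
  -- Conjugation by `τ ^ j` moves the fixed point into the limit set, where first the `τ`-part and
  -- then the `F`-part must vanish.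
  · have h1 : τ ^ (j + l) • ι g • τ ^ j • x = τ ^ j • x := by
      conv_rhs => rw [h0]
      simp [zpow_add, mul_smul]
    have h2 : j + l = 0 := c.eq_zero_of_zpow_mem (c.ext_mem hg g)
      (by rw [← h.ext_smul, ← h.zpow_smul, h1]; exact hg)
    rw [h2, zpow_zero, one_smul, h.ext_smul] at h1
    have h3 := c.eq_one_of_ext hg h1
    filter_upwards [he] with z hz
    rw [hz, h3, map_one, mul_one, ← zpow_add, add_comm, h2]; simp

/-- With `smul_injective`, this identifies the orbit of a point of the limit set with `ℤ × F`. -/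
theorem exists_smul_eq [ContinuousConstSMul Γ (Digits k)] {x : Digits k} (hx : x ∈ c.limitSet)
    (γ : Γ) : ∃ (l : ℤ) (g : F), γ • x = τ ^ l • ι g • x := by
  obtain ⟨l, j, g, hg, he⟩ := h.germ γ x
  have h0 := he.self_of_nhds
  rcases hg with rfl | hg
  · exact ⟨l + j, 1, by rw [h0]; simp [zpow_add, mul_smul]⟩
  · rw [h.zpow_smul] at hg
    rw [c.eq_zero_of_zpow_mem hx hg] at h0
    exact ⟨l, g, by rw [h0]; simp [mul_smul]⟩

theorem smul_injective {x : Digits k} (hx : x ∈ c.limitSet) {l l' : ℤ} {g g' : F}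
    (he : τ ^ l • ι g • x = τ ^ l' • ι g' • x) : l = l' ∧ g = g' := by
  have h1 : τ ^ (-l' + l) • ι g • x = ι g' • x := by rw [zpow_add, mul_smul, he]; simp
  have h2 : -l' + l = 0 := c.eq_zero_of_zpow_mem (c.ext_mem hx g) (by
    rw [← h.ext_smul, ← h.zpow_smul, h1, h.ext_smul]; exact c.ext_mem hx g')
  have h3 : l = l' := by omega
  subst h3
  rw [h2, zpow_zero, one_smul] at h1
  have h4 : ι (g'⁻¹ * g) • x = x := by rw [map_mul, mul_smul, h1, ← mul_smul, ← map_mul]; simp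
  rw [h.ext_smul] at h4
  exact ⟨rfl, (inv_mul_eq_one.1 (c.eq_one_of_ext hx h4)).symm⟩

theorem isMinimal : MulAction.IsMinimal Γ (Digits k) := by
  refine ⟨fun x => dense_iff_inter_open.2 fun U hU ⟨y, hy⟩ => ?_⟩
  obtain ⟨m, hm⟩ := exists_agree_subset hU hy
  obtain ⟨j, hj⟩ := exists_zpow_agree x y m
  exact ⟨τ ^ j • x, hm _ (by rw [h.zpow_smul]; exact hj), τ ^ j, rfl⟩

/-! ### Almost finiteness -/

theorem tile_eq [DecidableEq Γ] {s : Digits k} {m : ℕ} (hs : ∀ i < m, s i = 0) :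
    tile ((Finset.range (radix k m)).image fun i => τ ^ i) s = {x | ∀ i, m ≤ i → x i = s i} := by
  have hp : ∀ i : ℕ, τ ^ i • s = (odo ^ i) s := fun i => by
    rw [← zpow_natCast, h.zpow_smul, zpow_natCast]
  ext x
  simp only [tile, Set.mem_image, Finset.coe_image, Finset.coe_range, exists_exists_and_eq_and,
    Set.mem_ofPred_eq, Set.mem_Iio, hp]
  constructor
  · rintro ⟨i, hi, rfl⟩
    exact (val_pow hs hi).2
  · exact fun hx => ⟨val x m, val_lt x m, pow_val_of_tail hs hx⟩

omit h in
theorem ncard_tail (s : Digits k) (m : ℕ) : {x : Digits k | ∀ i, m ≤ i → x i = s i}.ncard =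
    radix k m := by
  have : Function.Bijective fun x : {x : Digits k | ∀ i, m ≤ i → x i = s i} =>
      fun i : Fin m => x.1 i := by
    constructor
    · rintro ⟨x, hx⟩ ⟨x', hx'⟩ he
      refine Subtype.ext (funext fun i => ?_)
      rcases lt_or_ge i m with hi | hi
      · exact congrFun he ⟨i, hi⟩
      · exact (hx i hi).trans (hx' i hi).symm
    · intro u
      exact ⟨⟨fun i => if hi : i < m then u ⟨i, hi⟩ else s i, fun i hi => by
        simp [not_lt.2 hi]⟩, funext fun i => by simp⟩
  rw [← Nat.card_coe_set_eq, Nat.card_eq_of_bijective _ this, Nat.card_pi]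
  simp [radix, Finset.prod_range]

/-- `τ` and `τ⁻¹` leave the tile only at its last and first point; `ι g` can change digits from `m`
on only if the first `m` digits are coherent. -/
theorem innerBoundary_subset {Sig : Finset Γ} (hSig : ∀ σ ∈ Sig, σ⁻¹ ∈ Sig)
    (hS : ∀ σ ∈ Sig, σ = τ ∨ σ = τ⁻¹ ∨ ∃ g, σ = ι g) {s : Digits k} {m : ℕ}
    (hs : ∀ i < m, s i = 0) :
    innerBoundary (orbitGraph Sig) {x | ∀ i, m ≤ i → x i = s i} ⊆
      {x | (∀ i, m ≤ i → x i = s i) ∧ c.Coherent m x} ∪ {s, (odo ^ (radix k m - 1)) s} := by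
  rintro x ⟨hx, y, hy, hadj⟩
  have hx' : ∀ i, m ≤ i → x i = s i := hx
  obtain ⟨σ, hσ, rfl⟩ : ∃ σ ∈ Sig, σ • x = y := by
    rcases (SimpleGraph.fromRel_adj _ _ _).1 hadj with ⟨-, h1 | ⟨σ, hσ, h1⟩⟩
    · exact h1
    · exact ⟨σ⁻¹, hSig σ hσ, by rw [← h1, inv_smul_smul]⟩
  have hv := val_lt x m
  have hxs : (odo ^ val x m) s = x := pow_val_of_tail hs hx'
  rcases hS σ hσ with rfl | rfl | ⟨g, rfl⟩
  · right; right
    by_contra hne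
    refine hy ?_
    rw [h.odo_smul, ← hxs, ← Equiv.Perm.mul_apply, ← pow_succ']
    refine (val_pow hs (lt_of_le_of_ne hv fun he => hne ?_)).2
    rw [Set.mem_singleton_iff, ← he, Nat.succ_sub_one, hxs]
  · right; left
    by_contra hne
    obtain ⟨n, hn⟩ := Nat.exists_eq_succ_of_ne_zero (n := val x m) fun h0 => hne (by
      rw [h0] at hxs; exact hxs.symm)
    refine hy ?_
    rw [← zpow_neg_one, h.zpow_smul, ← hxs, hn, Nat.succ_eq_add_one, pow_succ', zpow_neg_one,
      Equiv.Perm.mul_apply, ← Equiv.Perm.mul_apply, inv_mul_cancel, Equiv.Perm.one_apply]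
    exact (val_pow hs (by omega)).2
  · left
    refine ⟨hx', by_contra fun hne => hy fun i hi => ?_⟩
    rw [h.ext_smul, c.ext_tail hne hi, hx' i hi]

omit h in
theorem ncard_coherent_le (s : Digits k) (m : ℕ) :
    {x | (∀ i, m ≤ i → x i = s i) ∧ c.Coherent m x}.ncard ≤
      (Set.range fun (y : K) (i : Fin m) => c.code y i).ncard := by
  refine Set.ncard_le_ncard_of_injOn (fun x (i : Fin m) => x i) ?_ ?_ (Set.toFinite _)
  · rintro x ⟨-, y, hy⟩
    exact ⟨y, funext fun i => (hy i i.2).symm⟩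
  · rintro x ⟨hx, -⟩ x' ⟨hx', -⟩ he
    refine funext fun i => ?_
    rcases lt_or_ge i m with hi | hi
    · exact congrFun he ⟨i, hi⟩
    · exact (hx i hi).trans (hx' i hi).symm

theorem isAlmostFinite {Sig : Finset Γ} (hSig : ∀ σ ∈ Sig, σ⁻¹ ∈ Sig)
    (hS : ∀ σ ∈ Sig, σ = τ ∨ σ = τ⁻¹ ∨ ∃ g, σ = ι g) : IsAlmostFinite (Digits k) Sig := by
  classical
  intro ε hε
  obtain ⟨m, hm⟩ := c.small ε hε
  have hopen : IsClopen {s : Digits k | ∀ i < m, s i = 0} := by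
    simpa using (isLocallyConstant_of_agree (fun s : Digits k => ∀ i < m, s i = 0) m
      fun x x' hx => propext (forall₂_congr fun i hi => by rw [hx i hi])).isClopen_fiber True
  refine ⟨1, fun _ => {s | ∀ i < m, s i = 0},
    fun _ => (Finset.range (radix k m)).image fun i => τ ^ i, ?_, ?_, ?_, ?_⟩
  · refine fun _ => ⟨hopen, fun s hs t ht hne => ?_⟩
    rw [h.tile_eq hs, h.tile_eq ht]
    refine Set.disjoint_left.2 fun x hx hx' => hne (funext fun i => ?_)
    rcases lt_or_ge i m with hi | hi
    · rw [hs i hi, ht i hi]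
    · exact (hx i hi).symm.trans (hx' i hi)
  · exact fun i j hij => absurd (Subsingleton.elim i j) hij
  · intro x
    have hs : ∀ i < m, (fun i => if i < m then 0 else x i : Digits k) i = 0 :=
      fun i hi => if_pos hi
    refine ⟨0, _, hs, ?_⟩
    rw [h.tile_eq hs]
    exact fun i hi => (if_neg (not_lt.2 hi)).symm
  · intro _ s hs
    rw [h.tile_eq hs, isoperimetricConstant, ncard_tail]
    refine le_trans (div_le_div_of_nonneg_right ?_ (Nat.cast_nonneg _)) hm
    have hfin : {x : Digits k | ∀ i, m ≤ i → x i = s i}.Finite :=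
      Set.finite_of_ncard_pos (by rw [ncard_tail]; exact radix_pos m)
    have h1 := Set.ncard_le_ncard (h.innerBoundary_subset hSig hS hs)
      ((hfin.subset fun x hx => hx.1).union (Set.toFinite _))
    have h2 := h1.trans (Set.ncard_union_le _ _)
    have h3 := ncard_coherent_le (c := c) s m
    have h4 : ({s, (odo ^ (radix k m - 1)) s} : Set (Digits k)).ncard ≤ 2 :=
      (Set.ncard_insert_le _ _).trans (by rw [Set.ncard_singleton])
    exact_mod_cast h2.trans (Nat.add_le_add h3 h4)

end IsRealization

end Coding

/-! ### Non-amenability of the free group, averaged over a probability space -/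

namespace FreeGroup

variable {K : Type*} [MeasurableSpace K] {μ : Measure K} [IsProbabilityMeasure μ]
  [MulAction (FreeGroup Bool) K]

/-- The mean of `u` with respect to the average of the measures `q y`, transported by inversion. -/
noncomputable def mean (μ : Measure K) (q : K → FreeGroup Bool → ℝ≥0∞)
    (u : FreeGroup Bool → ℝ≥0∞) : ℝ≥0∞ :=
  ∫⁻ y, ∑' g, u g⁻¹ * q y g ∂μ

omit [IsProbabilityMeasure μ] [MulAction (FreeGroup Bool) K] in
theorem mean_mono {q : K → FreeGroup Bool → ℝ≥0∞} {u v : FreeGroup Bool → ℝ≥0∞}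
    (h : ∀ g, u g ≤ v g) : mean μ q u ≤ mean μ q v :=
  lintegral_mono fun _ => ENNReal.tsum_le_tsum fun _ => mul_le_mul_left (h _) _

variable {q : K → FreeGroup Bool → ℝ≥0∞} (hq : ∀ g, Measurable fun y => q y g)
include hq

omit [IsProbabilityMeasure μ] [MulAction (FreeGroup Bool) K] in
theorem measurable_tsum_mul (u : FreeGroup Bool → ℝ≥0∞) :
    Measurable fun y => ∑' g, u g⁻¹ * q y g :=
  Measurable.tsum fun g => (hq g).const_mul _

omit [IsProbabilityMeasure μ] [MulAction (FreeGroup Bool) K] in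
theorem mean_add (u v : FreeGroup Bool → ℝ≥0∞) :
    mean μ q (fun g => u g + v g) = mean μ q u + mean μ q v := by
  simp only [mean, add_mul, ENNReal.tsum_add]
  exact lintegral_add_left (measurable_tsum_mul hq u) _

/-- Invariance of `μ` replaces `q y` by `q (s • y)`, nearly a right translate of `q y`; the
inversion in `mean` turns this into a left translation of `u`. -/
theorem mean_le_translate (hμ : ∀ g : FreeGroup Bool, MeasurePreserving (fun y => g • y) μ μ)
    {s : FreeGroup Bool} {ε : ℝ≥0∞}
    (h : ∀ y, ∃ δ : FreeGroup Bool → ℝ≥0∞,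
      (∀ g, q (s • y) g ≤ q y (g * s) + δ g) ∧ ∑' g, δ g ≤ ε)
    {u : FreeGroup Bool → ℝ≥0∞} (hu : ∀ g, u g ≤ 1) :
    mean μ q u ≤ mean μ q (fun g => u (s * g)) + ε := by
  calc mean μ q u = ∫⁻ y, ∑' g, u g⁻¹ * q (s • y) g ∂μ :=
        ((hμ s).lintegral_comp (measurable_tsum_mul hq u)).symm
    _ ≤ ∫⁻ y, (∑' g, u (s * g⁻¹) * q y g) + ε ∂μ := by
        refine lintegral_mono fun y => ?_
        obtain ⟨δ, h1, h2⟩ := h y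
        have h3 : ∑' g, u g⁻¹ * q y (g * s) = ∑' g, u (s * g⁻¹) * q y g := by
          rw [← (Equiv.mulRight s).tsum_eq fun g => u (s * g⁻¹) * q y g]
          simp
        rw [← h3]
        refine le_trans ?_ (add_le_add_right h2 _)
        rw [← ENNReal.tsum_add]
        refine ENNReal.tsum_le_tsum fun g => ?_
        refine (mul_le_mul_right (h1 g) _).trans ?_
        rw [mul_add]
        exact add_le_add_right (mul_le_of_le_one_left' (hu _)) _
    _ = mean μ q (fun g => u (s * g)) + ε := by
        rw [lintegral_add_right _ measurable_const]; simp [mean]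

/-- There is no measurable family of almost equivariant probability measures on the free group
over a space with an invariant probability measure. -/
theorem not_almost_equivariant
    (hμ : ∀ g : FreeGroup Bool, MeasurePreserving (fun y => g • y) μ μ)
    (h1 : ∀ y, ∑' g, q y g = 1)
    (h2 : ∀ b y, ∃ δ : FreeGroup Bool → ℝ≥0∞,
      (∀ g, q (of b • y) g ≤ q y (g * of b) + δ g) ∧ ∑' g, δ g ≤ 1 / 4) : False := by
  classical
  let χ : Bool × Bool → FreeGroup Bool → ℝ≥0∞ := fun w => (startsWith w).indicator 1
  have hχ : ∀ w g, χ w g ≤ 1 := fun w g => Set.indicator_le_self' (by simp) g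
  have hone : mean μ q (fun _ => 1) = 1 := by simp [mean, h1]
  -- Every `g` starts with `b`, or `b⁻¹ * g` starts with `b⁻¹`.
  have hb : ∀ b, 1 ≤ mean μ q (χ (b, true)) + mean μ q (χ (b, false)) + 1 / 4 := by
    intro b
    have h3 := mean_le_translate hq hμ (h2 b) (u := fun g => χ (b, false) ((of b)⁻¹ * g))
      fun g => hχ _ _
    simp only [inv_mul_cancel_left] at h3
    rw [add_assoc]
    refine le_trans ?_ (add_le_add_right h3 _)
    rw [← mean_add hq, ← hone]
    refine mean_mono fun g => ?_
    by_cases hg : (of b)⁻¹ * g ∈ startsWith (b, false)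
    · simp [χ, Set.indicator_of_mem hg]
    · have h4 := startsWith_mk_mul (w := (b, true)) ((of b)⁻¹ * g) hg
      have h5 : g ∈ startsWith (b, true) := by
        have : mk [(b, true)] * ((of b)⁻¹ * g) = g := mul_inv_cancel_left (of b) g
        rwa [this] at h4
      simp [χ, Set.indicator_of_mem h5]
  -- The four sets of words with a given first letter are disjoint. Adding `hb` for both generators
  -- gives `2 - 1/2 ≤ 1`.
  have hsum : mean μ q (χ (true, true)) + mean μ q (χ (true, false)) +
      (mean μ q (χ (false, true)) + mean μ q (χ (false, false))) ≤ 1 := by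
    rw [← mean_add hq, ← mean_add hq, ← mean_add hq, ← hone]
    refine mean_mono fun g => ?_
    have hd : ∀ w w', g ∈ startsWith w → w ≠ w' → g ∉ startsWith w' := fun w w' hg hne =>
      Set.disjoint_left.1 (startsWith.disjoint_iff_ne.2 hne) hg
    by_cases hg : ∃ w, g ∈ startsWith w
    · obtain ⟨w, hg⟩ := hg
      have h0 : ∀ w', χ w' g = if w = w' then 1 else 0 := fun w' => by
        split_ifs with h
        · subst h; exact Set.indicator_of_mem hg _
        · exact Set.indicator_of_notMem (hd w w' hg h) _
      simp only [h0]
      rcases w with ⟨_ | _, _ | _⟩ <;> simp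
    · push Not at hg
      simp [χ, Set.indicator_of_notMem (hg _)]
  have ht := hb true
  have hf := hb false
  generalize mean μ q (χ (true, true)) + mean μ q (χ (true, false)) = A at *
  generalize mean μ q (χ (false, true)) + mean μ q (χ (false, false)) = B at *
  have hA : A ≠ ∞ := ne_top_of_le_ne_top ENNReal.one_ne_top (le_self_add.trans hsum)
  have hB : B ≠ ∞ := ne_top_of_le_ne_top ENNReal.one_ne_top (le_add_self.trans hsum)
  lift A to NNReal using hA
  lift B to NNReal using hB
  have h4 : (1 / 4 : ℝ≥0∞) = ((1 / 4 : NNReal) : ℝ≥0∞) := by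
    rw [ENNReal.coe_div (by norm_num)]; norm_num
  rw [h4] at ht hf
  norm_cast at ht hf hsum
  have ht' : (1 : ℝ) ≤ A + 1 / 4 := by exact_mod_cast ht
  have hf' : (1 : ℝ) ≤ B + 1 / 4 := by exact_mod_cast hf
  have hs' : (A : ℝ) + B ≤ 1 := by exact_mod_cast hsum
  linarith

end FreeGroup

/-! ### Non-amenability of the action and of its orbit groupoid -/

namespace Coding.IsRealization

variable {k : ℕ → ℕ} {K : Type*} [MulAction (FreeGroup Bool) K] {c : Coding k (FreeGroup Bool) K}
  {Γ : Type*} [Group Γ] [MulAction Γ (Digits k)] {τ : Γ} {ι : FreeGroup Bool →* Γ}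
  [TopologicalSpace K] [MeasurableSpace K] [BorelSpace K] {μ : Measure K} [IsProbabilityMeasure μ]
  [ContinuousConstSMul Γ (Digits k)]

theorem not_isOrbitGroupoidAmenable (h : c.IsRealization τ ι) (hc : Continuous c.code)
    (hμ : ∀ g : FreeGroup Bool, MeasurePreserving (fun y => g • y) μ μ) :
    ¬ IsOrbitGroupoidAmenable Γ (Digits k) := by
  classical
  intro ha
  obtain ⟨p, hp0, hp1, hp2, hp3, hp4⟩ :=
    ha (Finset.univ.image fun b => ι (FreeGroup.of b)) (1 / 4) (by norm_num)
  let J : Digits k → FreeGroup Bool × ℤ → Digits k := fun x i => τ ^ i.2 • ι i.1 • x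
  have hJ : ∀ x ∈ c.limitSet, Function.Injective (J x) := fun x hx i i' he => by
    obtain ⟨h1, h2⟩ := h.smul_injective hx he
    exact Prod.ext h2 h1
  have hJs : ∀ x ∈ c.limitSet, ∀ z, p x z ≠ 0 → z ∈ Set.range (J x) := by
    intro x hx z hz
    obtain ⟨γ, rfl⟩ : z ∈ MulAction.orbit Γ x := by_contra fun hn => hz (hp1 x z hn)
    obtain ⟨l, g, he⟩ := h.exists_smul_eq hx γ
    exact ⟨(g, l), he.symm⟩
  -- The measure on the orbit of a code, seen on `F × ℤ`, is projected to `F`.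
  refine FreeGroup.not_almost_equivariant (μ := μ)
    (q := fun y g => ∑' l : ℤ, ENNReal.ofReal (p (c.code y) (τ ^ l • ι g • c.code y)))
    ?_ hμ ?_ ?_
  · refine fun g => Measurable.tsum fun l => ENNReal.measurable_ofReal.comp ?_
    have := (hp3 (τ ^ l * ι g)).comp hc
    simp only [mul_smul] at this
    exact this.measurable
  · intro y
    have hy := c.code_mem y
    rw [← ENNReal.tsum_prod (f := fun g l => ENNReal.ofReal (p (c.code y) (J (c.code y) (g, l))))]
    rw [(hJ _ hy).tsum_eq (f := fun z => ENNReal.ofReal (p (c.code y) z)),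
      ← ENNReal.ofReal_tsum_of_nonneg (hp0 _) (hp2 _).summable, (hp2 _).tsum_eq, ENNReal.ofReal_one]
    intro z hz
    refine hJs _ hy z fun h0 => hz ?_
    simp [h0]
  · intro b y
    have hy := c.code_mem y
    have hs : c.code (FreeGroup.of b • y) = ι (FreeGroup.of b) • c.code y := by
      rw [h.ext_smul, c.ext_code]
    have hy' := c.code_mem (FreeGroup.of b • y)
    set x := c.code y
    set x' := c.code (FreeGroup.of b • y)
    -- Orbit coordinates are based at `x' = ι (of b) • x`; since `ι g • x' = ι (g * of b) • x`,
    -- changing the base point is a right translation.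
    refine ⟨fun g => ∑' l : ℤ, ENNReal.ofReal |p x (J x' (g, l)) - p x' (J x' (g, l))|, ?_, ?_⟩
    · intro g
      simp only [J]
      rw [← ENNReal.tsum_add]
      refine ENNReal.tsum_le_tsum fun l => ?_
      rw [map_mul, mul_smul, ← hs, ← ENNReal.ofReal_add (hp0 _ _) (abs_nonneg _)]
      refine ENNReal.ofReal_le_ofReal ?_
      have := neg_abs_le (p x (τ ^ l • ι g • x') - p x' (τ ^ l • ι g • x'))
      linarith
    · rw [← ENNReal.tsum_prod
        (f := fun g l => ENNReal.ofReal |p x (J x' (g, l)) - p x' (J x' (g, l))|)]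
      refine (ENNReal.tsum_comp_le_tsum_of_injective (hJ x' hy')
        fun z => ENNReal.ofReal |p x z - p x' z|).trans ?_
      rw [← ENNReal.ofReal_tsum_of_nonneg (fun _ => abs_nonneg _)
        ((hp2 x).summable.sub (hp2 x').summable).abs, hs]
      refine (ENNReal.ofReal_le_ofReal
        (hp4 _ (Finset.mem_image_of_mem _ (Finset.mem_univ b)) x)).trans ?_
      rw [ENNReal.ofReal_div_of_pos (by norm_num)]; simp

theorem not_isTopologicallyAmenable (h : c.IsRealization τ ι) (hc : Continuous c.code)
    [Countable Γ]
    (hμ : ∀ g : FreeGroup Bool, MeasurePreserving (fun y => g • y) μ μ) :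
    ¬ IsTopologicallyAmenable Γ (Digits k) := by
  classical
  intro ha
  obtain ⟨m, hm0, hm1, hm2, hm3⟩ :=
    ha (Finset.univ.image fun b => ι (FreeGroup.of b)) (1 / 4) (by norm_num)
  -- `m x` is pushed to the orbit by `γ ↦ γ⁻¹ • x` and then to `F`. The inverse makes left
  -- translation of `γ` a change of base point.
  let R : FreeGroup Bool → Γ → Digits k → Prop := fun g γ x => ∃ l : ℤ, γ⁻¹ • x = τ ^ l • ι g • x
  refine FreeGroup.not_almost_equivariant (μ := μ)
    (q := fun y g => ∑' γ : Γ, if R g γ (c.code y) then ENNReal.ofReal (m (c.code y) γ) else 0)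
    ?_ hμ ?_ ?_
  · refine fun g => Measurable.tsum fun γ => Measurable.ite ?_
      (ENNReal.measurable_ofReal.comp ((hm2 γ).comp hc).measurable) measurable_const
    simp only [R, Set.ofPred_exists]
    refine MeasurableSet.iUnion fun l => (isClosed_eq ?_ ?_).measurableSet
    · exact (continuous_const_smul _).comp hc
    · exact (continuous_const_smul _).comp ((continuous_const_smul _).comp hc)
  · intro y
    have hy := c.code_mem y
    rw [ENNReal.tsum_comm]
    rw [← ENNReal.ofReal_one, ← (hm1 (c.code y)).tsum_eq,
      ENNReal.ofReal_tsum_of_nonneg (hm0 _) (hm1 _).summable]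
    refine tsum_congr fun γ => ?_
    obtain ⟨l, g, he⟩ := h.exists_smul_eq hy γ⁻¹
    rw [tsum_eq_single g, if_pos ⟨l, he⟩]
    rintro g' hne
    refine if_neg ?_
    rintro ⟨l', he'⟩
    exact hne (h.smul_injective hy (he'.symm.trans he)).2
  · intro b y
    have hs : c.code (FreeGroup.of b • y) = ι (FreeGroup.of b) • c.code y := by
      rw [h.ext_smul, c.ext_code]
    have hy' := c.code_mem (FreeGroup.of b • y)
    set x := c.code y
    set x' := c.code (FreeGroup.of b • y)
    set s := FreeGroup.of b
    have hsum : Summable fun γ => |m x ((ι s)⁻¹ * γ) - m x' γ| :=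
      (((Equiv.mulLeft (ι s)⁻¹).summable_iff.2 (hm1 x).summable).sub (hm1 x').summable).abs
    refine ⟨fun g => ∑' γ : Γ, if R g γ x' then
      ENNReal.ofReal |m x ((ι s)⁻¹ * γ) - m x' γ| else 0, ?_, ?_⟩
    · intro g
      rw [← (Equiv.mulLeft (ι s)⁻¹).tsum_eq fun γ =>
        if R (g * s) γ x then ENNReal.ofReal (m x γ) else 0, ← ENNReal.tsum_add]
      refine ENNReal.tsum_le_tsum fun γ => ?_
      have hR : R (g * s) (Equiv.mulLeft (ι s)⁻¹ γ) x ↔ R g γ x' := by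
        simp only [R, hs, Equiv.coe_mulLeft, mul_inv_rev, inv_inv, mul_smul, map_mul]
      by_cases hg : R g γ x'
      · rw [if_pos hg, if_pos (hR.2 hg), if_pos hg,
          ← ENNReal.ofReal_add (hm0 _ _) (abs_nonneg _)]
        refine ENNReal.ofReal_le_ofReal ?_
        have := neg_abs_le (m x ((ι s)⁻¹ * γ) - m x' γ)
        rw [Equiv.coe_mulLeft]
        linarith
      · rw [if_neg hg]; exact zero_le
    · rw [ENNReal.tsum_comm]
      calc _ ≤ ∑' γ, ENNReal.ofReal |m x ((ι s)⁻¹ * γ) - m x' γ| := by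
            refine ENNReal.tsum_le_tsum fun γ => ?_
            obtain ⟨l, g, he⟩ := h.exists_smul_eq hy' γ⁻¹
            rw [tsum_eq_single g, if_pos ⟨l, he⟩]
            rintro g' hne
            refine if_neg ?_
            rintro ⟨l', he'⟩
            exact hne (h.smul_injective hy' (he'.symm.trans he)).2
        _ = ENNReal.ofReal (∑' γ, |m x ((ι s)⁻¹ * γ) - m x' γ|) :=
            (ENNReal.ofReal_tsum_of_nonneg (fun _ => abs_nonneg _) hsum).symm
        _ ≤ ENNReal.ofReal (1 / 4) := by
            rw [hs]
            exact ENNReal.ofReal_le_ofReal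
              (hm3 _ (Finset.mem_image_of_mem _ (Finset.mem_univ b)) x)
        _ ≤ 1 / 4 := by rw [ENNReal.ofReal_div_of_pos (by norm_num)]; simp

end Coding.IsRealization

/-! ### Invariance under conjugacy -/

section Transfer

variable {Γ X Y : Type*} [Group Γ] [MulAction Γ X] [MulAction Γ Y] [TopologicalSpace X]
  [TopologicalSpace Y] (Φ : X ≃ₜ Y) (hΦ : ∀ (γ : Γ) x, Φ (γ • x) = γ • Φ x)
include hΦ

theorem CantorAction.IsProperAction.of_homeomorph (h : IsProperAction Γ Y) :
    IsProperAction Γ X := by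
  intro γ x hx
  obtain ⟨U, hU, hxU, h⟩ := h γ (Φ x) (by rw [← hΦ, hx])
  exact ⟨Φ ⁻¹' U, hU.preimage Φ.continuous, hxU, fun y hy => Φ.injective (by
    rw [hΦ, h _ hy])⟩

theorem MulAction.IsMinimal.of_homeomorph (h : MulAction.IsMinimal Γ Y) :
    MulAction.IsMinimal Γ X := by
  refine ⟨fun x => ?_⟩
  have h1 := (h.dense_orbit (Φ x)).preimage Φ.isOpenMap
  convert h1 using 1
  ext z
  simp only [MulAction.mem_orbit_iff, Set.mem_preimage, ← hΦ, Φ.injective.eq_iff]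

theorem Homeomorph.image_tile (F : Finset Γ) (s : X) : Φ '' tile F s = tile F (Φ s) := by
  simp only [tile, Set.image_image, hΦ]

theorem Homeomorph.isoperimetricConstant_image (Sig : Finset Γ) (H : Set X) :
    isoperimetricConstant (orbitGraph Sig) (Φ '' H) = isoperimetricConstant (orbitGraph Sig) H := by
  have h1 : innerBoundary (orbitGraph Sig) (Φ '' H) = Φ '' innerBoundary (orbitGraph Sig) H := by
    ext z
    obtain ⟨x, rfl⟩ := Φ.surjective z
    rw [Φ.injective.mem_set_image]
    simp only [innerBoundary, Set.mem_ofPred_eq, Φ.injective.mem_set_image]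
    refine and_congr_right fun _ => Φ.surjective.exists.trans (exists_congr fun y => ?_)
    simp only [Φ.injective.mem_set_image, orbitGraph, SimpleGraph.fromRel_adj, ← hΦ,
      Φ.injective.eq_iff, ne_eq]
  rw [isoperimetricConstant, h1, Set.ncard_image_of_injective _ Φ.injective,
    Set.ncard_image_of_injective _ Φ.injective, isoperimetricConstant]

theorem CantorAction.IsAlmostFinite.of_homeomorph {Sig : Finset Γ} (h : IsAlmostFinite Y Sig) :
    IsAlmostFinite X Sig := by
  intro ε hε
  obtain ⟨m, S, F, h1, h2, h3, h4⟩ := h ε hε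
  have hd : ∀ (F F' : Finset Γ) (s t : X), Disjoint (tile F (Φ s)) (tile F' (Φ t)) →
      Disjoint (tile F s) (tile F' t) := fun F F' s t h => by
    rw [← Φ.image_tile hΦ, ← Φ.image_tile hΦ] at h
    exact (Set.disjoint_image_iff Φ.injective).1 h
  refine ⟨m, fun j => Φ ⁻¹' S j, F, fun j => ⟨(h1 j).1.preimage Φ.continuous,
    fun s hs t ht hne => hd _ _ _ _ ((h1 j).2 _ hs _ ht (Φ.injective.ne hne))⟩,
    fun i j hij s hs t ht => hd _ _ _ _ (h2 i j hij _ hs _ ht), fun x => ?_, fun j s hs => ?_⟩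
  · obtain ⟨j, s, hs, hx⟩ := h3 (Φ x)
    obtain ⟨s, rfl⟩ := Φ.surjective s
    rw [← Φ.image_tile hΦ, Φ.injective.mem_set_image] at hx
    exact ⟨j, s, hs, hx⟩
  · rw [← Φ.isoperimetricConstant_image hΦ, Φ.image_tile hΦ]
    exact h4 j _ hs

theorem CantorAction.IsTopologicallyAmenable.of_homeomorph (h : IsTopologicallyAmenable Γ Y) :
    IsTopologicallyAmenable Γ X := by
  intro E ε hε
  obtain ⟨m, h1, h2, h3, h4⟩ := h E ε hε
  exact ⟨fun x => m (Φ x), fun x => h1 _, fun x => h2 _, fun g => (h3 g).comp Φ.continuous,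
    fun γ hγ x => by simpa only [hΦ] using h4 γ hγ (Φ x)⟩

theorem CantorAction.IsOrbitGroupoidAmenable.of_homeomorph (h : IsOrbitGroupoidAmenable Γ Y) :
    IsOrbitGroupoidAmenable Γ X := by
  intro E ε hε
  obtain ⟨p, h0, h1, h2, h3, h4⟩ := h E ε hε
  refine ⟨fun x y => p (Φ x) (Φ y), fun _ _ => h0 _ _, fun x y hy => h1 _ _ ?_,
    fun x => Φ.toEquiv.hasSum_iff.2 (h2 (Φ x)), fun γ => ?_, fun γ hγ x => ?_⟩
  · rintro ⟨γ, hγ⟩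
    refine hy ⟨γ, Φ.injective ?_⟩
    rw [hΦ]; exact hγ
  · simp only [hΦ]; exact (h3 γ).comp Φ.continuous
  · refine le_trans (le_of_eq ?_) (h4 γ hγ (Φ x))
    rw [← hΦ]
    exact Φ.toEquiv.tsum_eq fun y => |p (Φ x) y - p (Φ (γ • x)) y|

end Transfer

/-! ### Residual finiteness of free groups -/

section ResiduallyFinite

/-- Left multiplication by `a` is a bijection between two subsets of the finite set `B`, so it
extends to a permutation. -/
theorem exists_perm_extending_mul {G : Type*} [Group G] (B : Finset G) (a : G) :
    ∃ π : Equiv.Perm B, ∀ (x : B) (hx : a * x ∈ B), π x = ⟨a * x, hx⟩ := by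
  classical
  let e : {x : B // a * x ∈ B} ≃ {x : B // a⁻¹ * x ∈ B} :=
    { toFun := fun x => ⟨⟨a * x, x.2⟩, by simp⟩
      invFun := fun x => ⟨⟨a⁻¹ * x, x.2⟩, by simp⟩
      left_inv := fun x => by simp
      right_inv := fun x => by simp }
  exact ⟨e.extendSubtype, fun x hx => e.extendSubtype_apply_of_mem x hx⟩

/-- A free group is residually finite: a nontrivial element moves a point in a finite set. -/
theorem FreeGroup.exists_perm_ne_one {α : Type*} {g : FreeGroup α} (hg : g ≠ 1) :
    ∃ (n : ℕ) (φ : FreeGroup α →* Equiv.Perm (Fin n)), φ g ≠ 1 := by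
  classical
  -- The suffixes of the reduced word of `g`: applying its letters from the right leads from `1` to
  -- `g` inside `B`.
  let B : Finset (FreeGroup α) := (g.toWord.tails.map mk).toFinset
  have hB : ∀ L, L <:+ g.toWord → mk L ∈ B := fun L hL =>
    List.mem_toFinset.2 (List.mem_map_of_mem ((List.mem_tails _ _).2 hL))
  choose π hπ using fun a : α => exists_perm_extending_mul B (of a)
  have key : ∀ L (hL : L <:+ g.toWord),
      lift π (mk L) ⟨1, hB [] List.nil_suffix⟩ = ⟨mk L, hB L hL⟩ := by
    intro L
    induction L with
    | nil => exact fun _ => rfl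
    | cons w L ih =>
      intro hL
      have hL' : L <:+ g.toWord := (List.suffix_cons w L).trans hL
      obtain ⟨a, _ | _⟩ := w
      · have h1 : mk ((a, false) :: L) = (of a)⁻¹ * mk L := rfl
        have h2 : of a * mk ((a, false) :: L) = mk L := by rw [h1, mul_inv_cancel_left]
        have h3 := hπ a ⟨mk ((a, false) :: L), hB _ hL⟩ (h2 ▸ hB L hL')
        have h4 : lift π (mk ((a, false) :: L)) = (π a)⁻¹ * lift π (mk L) := by
          rw [h1, _root_.map_mul, _root_.map_inv, lift_apply_of]
        rw [h4, Equiv.Perm.mul_apply, ih hL', Equiv.Perm.inv_eq_iff_eq, h3]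
        exact Subtype.ext h2.symm
      · have h4 : lift π (mk ((a, true) :: L)) = π a * lift π (mk L) := by
          rw [← lift_apply_of (f := π), ← _root_.map_mul]; rfl
        rw [h4, Equiv.Perm.mul_apply, ih hL']
        exact hπ a ⟨mk L, hB L hL'⟩ (hB _ hL)
  refine ⟨B.card, B.equivFin.permCongrHom.toMonoidHom.comp (lift π), fun h => hg ?_⟩
  have h1 : lift π g = 1 := B.equivFin.permCongrHom.injective
    (h.trans (_root_.map_one B.equivFin.permCongrHom).symm)
  have h2 := congrArg Subtype.val (key g.toWord List.suffix_rfl)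
  simp only [mk_toWord, h1] at h2
  exact h2.symm

end ResiduallyFinite

/-! ### One-hot coding of a product of finite groups -/

namespace OneHot

variable (H : ℕ → Type) [∀ i, Group (H i)] [∀ i, Fintype (H i)] [∀ i, DecidableEq (H i)]

/-- The product of the first `n + 1` groups. -/
abbrev Level (n : ℕ) : Type := ∀ i : Fin (n + 1), H i

/-- Words indexed by the elements of `Level H n`. -/
abbrev Block (n : ℕ) : Type := Level H n → Bool

/-- The largest digit. -/
def maxDigit (n : ℕ) : ℕ := 2 ^ Fintype.card (Level H n) - 1

omit [∀ i, Group (H i)] [∀ i, DecidableEq (H i)] in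
theorem maxDigit_add_one (n : ℕ) : maxDigit H n + 1 = 2 ^ Fintype.card (Level H n) :=
  Nat.sub_add_cancel Nat.one_le_two_pow

omit [∀ i, Group (H i)] in
theorem exists_equiv (n : ℕ) :
    ∃ e : Block H n ≃ Fin (maxDigit H n + 1), e (fun _ => false) = 0 := by
  have e : Block H n ≃ Fin (maxDigit H n + 1) :=
    Fintype.equivFinOfCardEq (by simp [maxDigit_add_one])
  exact ⟨e.trans (Equiv.swap (e fun _ => false) 0), by simp⟩

/-- A numbering of the words of a block, where the zero word has number zero. -/
noncomputable def number (n : ℕ) : Block H n ≃ Fin (maxDigit H n + 1) :=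
  (exists_equiv H n).choose

omit [∀ i, Group (H i)] in
theorem number_false (n : ℕ) : number H n (fun _ => false) = 0 := (exists_equiv H n).choose_spec

/-- The Cantor space is the space of sequences of digits. -/
theorem nonempty_homeomorph : Nonempty (CantorSpace ≃ₜ Digits (maxDigit H)) := by
  -- All bit positions of all blocks are enumerated by `ℕ`.
  obtain ⟨d⟩ : Nonempty (ℕ ≃ Σ n, Level H n) := by
    have : Infinite (Σ n, Level H n) :=
      Infinite.of_injective (fun n : ℕ => (⟨n, fun _ => 1⟩ : Σ n, Level H n)) fun a b h =>
        congrArg Sigma.fst h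
    exact nonempty_equiv_of_countable
  let f : CantorSpace ≃ Digits (maxDigit H) :=
    (Equiv.arrowCongr d (Equiv.refl Bool)).trans
      ((Equiv.piCurry fun n (_ : Level H n) => Bool).trans (Equiv.piCongrRight (number H)))
  have hf : Continuous f := continuous_pi fun n => by
    refine (continuous_of_discreteTopology (f := number H n)).comp (continuous_pi fun v => ?_)
    exact continuous_apply (d.symm ⟨n, v⟩)
  exact ⟨hf.homeoOfEquivCompactToT2⟩

variable {H}

/-- The indicator function of a point. -/
def oneHot {n : ℕ} (v : Level H n) : Block H n := fun w => decide (w = v)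

omit [∀ i, Group (H i)] [∀ i, Fintype (H i)] in
theorem oneHot_injective {n : ℕ} : Function.Injective (oneHot : Level H n → Block H n) :=
  fun v w h => by simpa [oneHot] using congrFun h v

omit [∀ i, Group (H i)] [∀ i, Fintype (H i)] in
theorem oneHot_ne_false {n : ℕ} (v : Level H n) : oneHot v ≠ fun _ => false :=
  fun h => by simpa [oneHot] using congrFun h v

/-- The permutation action of a group on the words of a block. -/
def blockHom (n : ℕ) : Level H n →* Equiv.Perm (Block H n) where
  toFun g := Equiv.arrowCongr (Equiv.mulLeft g) (Equiv.refl Bool)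
  map_one' := by
    ext a v : 2
    change a (1⁻¹ * v) = a v
    rw [inv_one, one_mul]
  map_mul' g h := by
    ext a v : 2
    change a ((g * h)⁻¹ * v) = a (h⁻¹ * (g⁻¹ * v))
    rw [mul_inv_rev, mul_assoc]

omit [∀ i, Fintype (H i)] in
theorem blockHom_oneHot {n : ℕ} (g v : Level H n) : blockHom n g (oneHot v) = oneHot (g * v) := by
  funext w
  simp [blockHom, oneHot, inv_mul_eq_iff_eq_mul]

variable {F : Type*} [Group F] (φ : ∀ i, F →* H i)

/-- The homomorphism to the product of the first groups. -/
def levelHom (n : ℕ) : F →* Level H n := MonoidHom.pi fun i => φ i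

/-- The action on the product of all groups by left translations. -/
abbrev productAction : MulAction F (∀ i, H i) := MulAction.compHom _ (MonoidHom.pi φ)

omit [∀ i, Group (H i)] [∀ i, DecidableEq (H i)] in
-- `(v + 2) / 2 ^ v` tends to 0, and nontrivial factors give `v ≥ 2 ^ (n + 1)`.
theorem exists_small (hH : ∀ i, Nontrivial (H i)) {ε : ℝ} (hε : 0 < ε) : ∃ n,
    (Fintype.card (Level H n) + 2 : ℝ) / 2 ^ Fintype.card (Level H n) ≤ ε := by
  have h1 : Filter.Tendsto (fun v : ℕ => (v + 2 : ℝ) / 2 ^ v) Filter.atTop (𝓝 0) := by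
    have ha := tendsto_pow_const_div_const_pow_of_one_lt 1 (r := (2 : ℝ)) (by norm_num)
    have hb := tendsto_pow_const_div_const_pow_of_one_lt 0 (r := (2 : ℝ)) (by norm_num)
    have := ha.add (hb.const_mul 2)
    simp only [mul_zero, add_zero, pow_one, pow_zero] at this
    refine this.congr fun v => by ring
  have h2 : Filter.Tendsto (fun n => Fintype.card (Level H n)) Filter.atTop Filter.atTop := by
    refine Filter.tendsto_atTop_mono (fun n => ?_) Filter.tendsto_id
    rw [Fintype.card_pi]
    have h3 : ∏ _i : Fin (n + 1), 2 ≤ ∏ i : Fin (n + 1), Fintype.card (H i) :=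
      Finset.prod_le_prod' fun i _ => Fintype.one_lt_card
    rw [Finset.prod_const, Finset.card_univ, Fintype.card_fin] at h3
    exact (Nat.lt_two_pow_self.le.trans (Nat.pow_le_pow_right two_pos n.le_succ)).trans h3
  exact ((h1.comp h2).eventually (ge_mem_nhds hε)).exists

/-- The coding of a product of finite groups by indicator functions. -/
noncomputable def coding (hH : ∀ i, Nontrivial (H i)) (hφ : ∀ g, (∀ i, φ i g = 1) → g = 1) :
    letI := productAction φ
    Coding (maxDigit H) F (∀ i, H i) :=
  letI := productAction φ
  have hcode : ∀ (y y' : ∀ i, H i) n,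
      number H n (oneHot fun i => y i) = number H n (oneHot fun i => y' i) →
      ∀ i ≤ n, y i = y' i := fun y y' n h i hi =>
    congrFun (oneHot_injective ((number H n).injective h)) ⟨i, Nat.lt_succ_of_le hi⟩
  { rho := fun n => ((number H n).permCongrHom.toMonoidHom.comp (blockHom n)).comp (levelHom φ n)
    code := fun y n => number H n (oneHot fun i => y i)
    one_le := fun n => by
      have h1 := maxDigit_add_one H n
      have h2 : 2 ^ 1 ≤ 2 ^ Fintype.card (Level H n) :=
        Nat.pow_le_pow_right two_pos Fintype.card_pos
      omega
    code_smul := fun g y n => by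
      simp only [MonoidHom.comp_apply, MulEquiv.toMonoidHom_eq_coe, MonoidHom.coe_coe,
        Equiv.permCongrHom_coe, Equiv.permCongr_apply, Equiv.symm_apply_apply, blockHom_oneHot]
      rfl
    code_ne_zero := fun y n h => oneHot_ne_false _
      ((number H n).injective (h.trans (number_false H n).symm))
    code_eq := fun y y' n h i hi => by
      have h1 : ∀ j : Fin (i + 1), y j = y' j := fun j =>
        hcode y y' n h j ((Nat.lt_succ_iff.1 j.2).trans hi.le)
      simp only [h1]
    free := fun g hg => hφ g fun n => by
      obtain ⟨y, hy⟩ := hg n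
      simp only [MonoidHom.comp_apply, MulEquiv.toMonoidHom_eq_coe, MonoidHom.coe_coe,
        Equiv.permCongrHom_coe, Equiv.permCongr_apply, Equiv.symm_apply_apply, blockHom_oneHot]
        at hy
      have h1 := oneHot_injective ((number H n).injective hy)
      exact congrFun (mul_eq_right.1 h1) (Fin.last n)
    small := fun ε hε => by
      -- A coherent word of length `n + 1` is determined by its last block, an element of `Level H
      -- n`, whereas the last digit alone takes `2 ^ |Level H n|` values.
      obtain ⟨n, hn⟩ := exists_small hH hε
      refine ⟨n + 1, le_trans ?_ hn⟩
      let f : Level H n → ∀ i : Fin (n + 1), Fin (maxDigit H i + 1) := fun u i =>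
        number H i (oneHot fun j => u ⟨j, j.2.trans_le i.2⟩)
      have h1 : (Set.range fun (y : ∀ i, H i) (i : Fin (n + 1)) =>
          number H i (oneHot fun j => y j)).ncard ≤ Fintype.card (Level H n) := by
        refine (Set.ncard_le_ncard (t := f '' Set.univ) ?_ (Set.toFinite _)).trans
          ((Set.ncard_image_le (Set.toFinite _)).trans ?_)
        · rintro _ ⟨y, rfl⟩
          exact ⟨fun i => y i, trivial, rfl⟩
        · rw [Set.ncard_univ, Nat.card_eq_fintype_card]
      have h2 : (2 ^ Fintype.card (Level H n) : ℝ) ≤ radix (maxDigit H) (n + 1) := by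
        rw [radix_succ, maxDigit_add_one]
        exact_mod_cast Nat.le_mul_of_pos_left _ (radix_pos n)
      have h3 : ((Set.range fun (y : ∀ i, H i) (i : Fin (n + 1)) =>
          number H i (oneHot fun j => y j)).ncard : ℝ) ≤ Fintype.card (Level H n) := by
        exact_mod_cast h1
      gcongr }

end OneHot

/-! ### Assembly of the example -/

theorem exists_action_of_family (H : ℕ → Type) [∀ i, Group (H i)] [∀ i, Fintype (H i)]
    [∀ i, DecidableEq (H i)] [∀ i, TopologicalSpace (H i)] [∀ i, DiscreteTopology (H i)]
    (hH : ∀ i, Nontrivial (H i)) (φ : ∀ i, FreeGroup Bool →* H i)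
    (hφ : ∀ g, (∀ i, φ i g = 1) → g = 1) :
    ∃ (Γ : Type) (_ : Group Γ) (Sig : Finset Γ) (_ : MulAction Γ CantorSpace)
      (_ : ContinuousConstSMul Γ CantorSpace),
      (∀ σ ∈ Sig, σ⁻¹ ∈ Sig) ∧
      Subgroup.closure (Sig : Set Γ) = ⊤ ∧
      CantorAction.IsProperAction Γ CantorSpace ∧
      MulAction.IsMinimal Γ CantorSpace ∧
      CantorAction.IsAlmostFinite CantorSpace Sig ∧
      ¬ CantorAction.IsTopologicallyAmenable Γ CantorSpace ∧
      ¬ CantorAction.IsOrbitGroupoidAmenable Γ CantorSpace := by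
  classical
  let := OneHot.productAction φ
  let c := OneHot.coding φ hH hφ
  obtain ⟨Φ⟩ := OneHot.nonempty_homeomorph H
  -- The acting group is free of rank three: `none` is the odometer, the other two letters generate
  -- `F`.
  let gen : Option Bool → Equiv.Perm (Digits (OneHot.maxDigit H)) := fun o =>
    o.elim odo fun b => c.ext (FreeGroup.of b)
  let act : MulAction (FreeGroup (Option Bool)) (Digits (OneHot.maxDigit H)) :=
    MulAction.compHom _ (FreeGroup.lift gen)
  have hact : ∀ (γ : FreeGroup (Option Bool)) (x : Digits (OneHot.maxDigit H)),
      γ • x = FreeGroup.lift gen γ x := fun _ _ => rfl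
  have h : c.IsRealization (FreeGroup.of none) (FreeGroup.map some) := by
    refine ⟨fun x => ?_, fun g x => ?_, ?_⟩
    · rw [hact, FreeGroup.lift_apply_of]; rfl
    · have : (FreeGroup.lift gen).comp (FreeGroup.map some) = c.ext := by
        ext b : 1
        simp [gen]
      rw [hact, ← this]; rfl
    · rw [eq_top_iff, ← FreeGroup.closure_range_of]
      refine Subgroup.closure_mono ?_
      rintro _ ⟨_ | b, rfl⟩
      · exact .inl rfl
      · exact .inr ⟨FreeGroup.of b, FreeGroup.map.of⟩
  have := h.continuousConstSMul
  let actC : MulAction (FreeGroup (Option Bool)) CantorSpace := Φ.toEquiv.mulAction _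
  have hΦ : ∀ (γ : FreeGroup (Option Bool)) x, Φ (γ • x) = γ • Φ x := fun γ x =>
    Φ.apply_symm_apply _
  have hcont : ContinuousConstSMul (FreeGroup (Option Bool)) CantorSpace :=
    ⟨fun γ => Φ.symm.continuous.comp ((continuous_const_smul γ).comp Φ.continuous)⟩
  let Sig : Finset (FreeGroup (Option Bool)) :=
    Finset.univ.image FreeGroup.of ∪ Finset.univ.image fun o => (FreeGroup.of o)⁻¹
  have hSig : ∀ σ ∈ Sig, σ⁻¹ ∈ Sig := by
    intro σ hσ
    simp only [Sig, Finset.mem_union, Finset.mem_image, Finset.mem_univ, true_and] at hσ ⊢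
    rcases hσ with ⟨o, rfl⟩ | ⟨o, rfl⟩
    · exact .inr ⟨o, rfl⟩
    · exact .inl ⟨o, (inv_inv _).symm⟩
  have hS : ∀ σ ∈ Sig, σ = FreeGroup.of none ∨ σ = (FreeGroup.of none)⁻¹ ∨
      ∃ g, σ = FreeGroup.map some g := by
    intro σ hσ
    simp only [Sig, Finset.mem_union, Finset.mem_image, Finset.mem_univ, true_and] at hσ
    rcases hσ with ⟨_ | b, rfl⟩ | ⟨_ | b, rfl⟩
    · exact .inl rfl
    · exact .inr (.inr ⟨FreeGroup.of b, FreeGroup.map.of.symm⟩)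
    · exact .inr (.inl rfl)
    · exact .inr (.inr ⟨(FreeGroup.of b)⁻¹, by rw [map_inv, FreeGroup.map.of]⟩)
  let : MeasurableSpace (∀ i, H i) := borel _
  have : BorelSpace (∀ i, H i) := ⟨rfl⟩
  let μ : Measure (∀ i, H i) := Measure.haarMeasure ⊤
  have : IsProbabilityMeasure μ := ⟨by
    have := Measure.haarMeasure_self (K₀ := (⊤ : TopologicalSpace.PositiveCompacts (∀ i, H i)))
    simpa using this⟩
  have hμ : ∀ g : FreeGroup Bool, MeasurePreserving (fun y : ∀ i, H i => g • y) μ μ := fun g =>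
    measurePreserving_mul_left μ (MonoidHom.pi φ g)
  have hc : Continuous c.code := continuous_pi fun n =>
    (continuous_of_discreteTopology
      (f := fun u : OneHot.Level H n => OneHot.number H n (OneHot.oneHot u))).comp
      (continuous_pi fun i => continuous_apply _)
  refine ⟨FreeGroup (Option Bool), inferInstance, Sig, actC, hcont, hSig, ?_,
    h.isProperAction.of_homeomorph Φ hΦ, h.isMinimal.of_homeomorph Φ hΦ,
    (h.isAlmostFinite hSig hS).of_homeomorph Φ hΦ, fun ha => ?_, fun ha => ?_⟩
  · rw [eq_top_iff, ← FreeGroup.closure_range_of]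
    refine Subgroup.closure_mono ?_
    rintro _ ⟨o, rfl⟩
    simp [Sig]
  · exact h.not_isTopologicallyAmenable hc hμ (ha.of_homeomorph Φ.symm fun γ x =>
      Φ.injective (by rw [hΦ]; simp))
  · exact h.not_isOrbitGroupoidAmenable hc hμ (ha.of_homeomorph Φ.symm fun γ x =>
      Φ.injective (by rw [hΦ]; simp))

theorem FreeGroup.exists_family :
    ∃ (n : ℕ → ℕ) (φ : ∀ i, FreeGroup Bool →* Equiv.Perm (Fin (n i))),
    (∀ i, Nontrivial (Equiv.Perm (Fin (n i)))) ∧ ∀ g, (∀ i, φ i g = 1) → g = 1 := by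
  have h : ∀ g : FreeGroup Bool, ∃ (n : ℕ) (φ : FreeGroup Bool →* Equiv.Perm (Fin n)),
      Nontrivial (Equiv.Perm (Fin n)) ∧ (φ g = 1 → g = 1) := by
    intro g
    by_cases hg : g = 1
    -- No factor is needed to detect `1`; `Fin 2` keeps this one nontrivial, as the growth of the
    -- blocks requires.
    · exact ⟨2, 1, inferInstance, fun _ => hg⟩
    · obtain ⟨n, φ, hφ⟩ := FreeGroup.exists_perm_ne_one hg
      exact ⟨n, φ, ⟨_, _, hφ⟩, fun h => absurd h hφ⟩
  obtain ⟨f, hf⟩ := exists_surjective_nat (FreeGroup Bool)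
  choose n φ h1 h2 using h
  refine ⟨fun i => n (f i), fun i => φ (f i), fun i => h1 _, fun g hg => ?_⟩
  obtain ⟨i, rfl⟩ := hf g
  exact h2 _ (hg i)

theorem mainTheorem6 :
    ∃ (Γ : Type) (_ : Group Γ) (Sig : Finset Γ) (_ : MulAction Γ CantorSpace)
      (_ : ContinuousConstSMul Γ CantorSpace),
      (∀ σ ∈ Sig, σ⁻¹ ∈ Sig) ∧
      Subgroup.closure (Sig : Set Γ) = ⊤ ∧
      CantorAction.IsProperAction Γ CantorSpace ∧
      MulAction.IsMinimal Γ CantorSpace ∧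
      CantorAction.IsAlmostFinite CantorSpace Sig ∧
      ¬ CantorAction.IsTopologicallyAmenable Γ CantorSpace ∧
      ¬ CantorAction.IsOrbitGroupoidAmenable Γ CantorSpace := by
  obtain ⟨n, φ, h1, h2⟩ := FreeGroup.exists_family
  let : ∀ i, TopologicalSpace (Equiv.Perm (Fin (n i))) := fun _ => ⊥
  have : ∀ i, DiscreteTopology (Equiv.Perm (Fin (n i))) := fun _ => ⟨rfl⟩
  exact exists_action_of_family (fun i => Equiv.Perm (Fin (n i))) h1 φ h2
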